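/- All graphs are finite and simple; $v(G)$ and $e(G)$ denote the numbers of vertices and edges of $G$. Triangle-trees are defined recursively: a single triangle is a triangle-tree, and a graph obtained from a triangle-tree by identifying a single vertex (respectively, an edge) of a new triangle with a vertex (respectively, an edge) of the triangle-tree is again a triangle-tree. For a graph $H$ put $\varphi(H) := e(H)-v(H)+1$ and $\kappa(H) := 2e(H)-3v(H)+3$. A graphon is a measurable symmetric function $W:[0,1]^2\to[0,1]$, and for a graph $G$ the homomorphism density of $G$ in $W$ is $$t_G(W) := \int_{[0,1]^{V(G)}} \prod_{ab\in E(G)} W(x_a,x_b)\, dx .$$ For a tree $T$, a graph $H$, $u\in V(T)$ and $v\in V(H)$, let $T*_u^v H$ be the graph obtained from disjoint copies of $T$ and $H$ by identifying $u$ with $v$. **Lemma.** Let $H$ be a triangle-tree and let $T$ be a tree with $e(T)\le \kappa(H)$. Then for every $u\in V(T)$, every $v\in V(H)$ and every graphon $W$, $$t_{T*_u^v H}(W) \;\ge\; \frac{t_{K_3}(W)^{\varphi(H)}}{t_{K_2}(W)^{\kappa(H)-e(T)}},$$ where the right-hand side is read as $0$ if $t_{K_2}(W)=0$ (that is, if $W=0$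 almost everywhere). -/

import Mathlib

open MeasureTheory

universe u v

/-- A graphon: a measurable symmetric function `W : [0,1]² → [0,1]`. -/
structure Graphon where
  toFun : unitInterval → unitInterval → ℝ
  measurable : Measurable (Function.uncurry toFun)
  symm : ∀ x y, toFun x y = toFun y x
  nonneg : ∀ x y, 0 ≤ toFun x y
  le_one : ∀ x y, toFun x y ≤ 1

/-- The value `W (x_a, x_b)` at an unordered pair `ab` of vertices (well defined as `W` is
symmetric), for a point `x` of `[0,1]^V`. -/
def Graphon.evalPair {V : Type u} (W : Graphon) (x : V → unitInterval) : Sym2 V → ℝ :=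
  Sym2.lift ⟨fun a b => W.toFun (x a) (x b), fun a b => W.symm (x a) (x b)⟩

open Classical in
/-- The homomorphism density `t_G(W) = E (∏_{ab ∈ E(G)} W (x_a, x_b))`, where the expectation is
integration with respect to the Lebesgue measure on `[0,1]^{V(G)}`. -/
noncomputable def homDensity {V : Type u} [Fintype V] (G : SimpleGraph V) (W : Graphon) : ℝ :=
  ∫ x : V → unitInterval, ∏ e ∈ G.edgeFinset, W.evalPair x e

/-- The number `e(G)` of edges. -/
noncomputable def numEdges {V : Type u} (G : SimpleGraph V) : ℕ := Nat.card G.edgeSet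

/-- `φ(H) = e(H) - v(H) + 1`. -/
noncomputable def phi {V : Type u} (H : SimpleGraph V) : ℤ :=
  (numEdges H : ℤ) - (Nat.card V : ℤ) + 1

/-- `κ(H) = 2 e(H) - 3 v(H) + 3`. -/
noncomputable def kappa {V : Type u} (H : SimpleGraph V) : ℤ :=
  2 * (numEdges H : ℤ) - 3 * (Nat.card V : ℤ) + 3

open Classical in
/-- The vertex set of the graph in which the vertex `u` of `U` is identified with the vertex `v`
of `V` is the disjoint union of `V` and `U ∖ {u}`; this map places `U` in it, sending `u` to `v`. -/
noncomputable def identifyMap {U : Type u} {V : Type v} (u : U) (v : V) (x : U) :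
    V ⊕ {x : U // x ≠ u} :=
  if h : x = u then Sum.inl v else Sum.inr ⟨x, h⟩

/-- The graph `T *_u^v H` obtained from disjoint copies of `T` and `H` by identifying the vertex
`u` of `T` with the vertex `v` of `H`. -/
noncomputable def identifyVertex {U : Type u} {V : Type v} (T : SimpleGraph U) (u : U)
    (H : SimpleGraph V) (v : V) : SimpleGraph (V ⊕ {x : U // x ≠ u}) :=
  H.map Sum.inl ⊔ T.map (identifyMap u v)

/-- The graph obtained from `H` and a new triangle by identifying an edge of the triangle with the
edge `ab` of `H`: there is one new vertex `none`, joined to exactly `a` and `b`. -/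
def identifyTriangleEdge {V : Type u} (H : SimpleGraph V) (a b : V) : SimpleGraph (Option V) :=
  H.map some ⊔
    SimpleGraph.fromEdgeSet {s(none, some a), s(none, some b)}

/-- Triangle-trees: a single triangle is a triangle-tree, and identifying a vertex (resp. an edge)
of a new triangle with a vertex (resp. an edge) of a triangle-tree gives a triangle-tree.
The class is closed under isomorphism. -/
inductive IsTriangleTree : {V : Type u} → SimpleGraph V → Prop
  | triangle {V : Type u} {G : SimpleGraph V}
      (e : G ≃g (⊤ : SimpleGraph (Fin 3))) : IsTriangleTree G
  | vertex {V V' : Type u} {H : SimpleGraph V} {G : SimpleGraph V'} (hH : IsTriangleTree H)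
      (a : V) (e : G ≃g identifyVertex (⊤ : SimpleGraph (Fin 3)) 0 H a) : IsTriangleTree G
  | edge {V V' : Type u} {H : SimpleGraph V} {G : SimpleGraph V'} (hH : IsTriangleTree H)
      (a b : V) (hab : H.Adj a b) (e : G ≃g identifyTriangleEdge H a b) : IsTriangleTree G

/-!
The proof is by entropy. The graph `T *_u^v H` can be built from a single vertex by adding vertices
one at a time, each joined either to one earlier vertex or to both ends of an earlier edge
(`TriangularExt`). If there are `p` steps of the first kind and `r` of the second, the graph has
`p + r + 1` vertices and `p + 2 r` edges, so `φ = r` and `κ = r - p`. A triangle-tree has such a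
construction with `p ≥ 1` (`IsTriangleTree.exists_triangularExt`), a tree has one with `r = 0`
(`SimpleGraph.IsTree.exists_triangularExt`), and the two can be carried out one after the other in
`T *_u^v H` (`TriangularExt.identifyVertex`), so that `e(T) ≤ κ(H)` says `p ≤ r` for the result.

Let `c(x, y)` be the codegree, `d(x)` the density of triangles at `x`, and `t₂`, `t₃` the edge and
triangle densities, with `t₃ > 0`. Draw a random triangle with density `W(x,y) W(y,z) W(x,z) / t₃`.
Its vertices have density `d / t₃`, and its edges have density `W c / t₃`. Along the construction, a
random copy of the graph is drawn in which each vertex and each edge has these marginals: a pendant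
vertex is drawn as the other end of a random edge, and a vertex over an edge as the third vertex of
a random triangle (`IsTriangularLaw.pendant`, `IsTriangularLaw.triangle`). A step of the first kind
multiplies the ratio of the weight `∏ W` to the density of the copy by `d / c`, and a step of the
second kind multiplies it by `c`; it starts as `t₃ / d`. By Jensen's inequality
(`IsTriangularLaw.exp_le_homDensity`), the logarithm of the homomorphism density is at least the
expectation of the logarithm of this ratio, which is
`log t₃ + (p - 1) E[log d] + (r - p) E[log c]`.
Gibbs' inequality gives `E[log d] ≥ log t₃` and `E[log c] ≥ log t₃ - log t₂`
(`Graphon.log_triangleDensity_le`, `Graphon.log_triangleDensity_sub_log_le`). The coefficients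
`p - 1` and `r - p` are nonnegative, so the total is at least `r log t₃ - (r - p) log t₂`.
-/

/-! ### Graphs built from pendant vertices and vertices over edges -/

/-- `TriangularExt G s t p r`: the vertex set `t` of `G` arises from `s` by adding vertices one at a
time, where `p` of them are joined to exactly one earlier vertex and `r` of them are joined to
exactly the two ends of an edge between earlier vertices. -/
inductive TriangularExt {V : Type u} (G : SimpleGraph V) (s : Set V) : Set V → ℕ → ℕ → Prop
  | refl : TriangularExt G s s 0 0
  | pendant {t : Set V} {p r : ℕ} {a z : V} (h : TriangularExt G s t p r) (ha : a ∈ t)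
      (hz : z ∉ t) (hadj : ∀ b ∈ t, G.Adj z b ↔ b = a) : TriangularExt G s (insert z t) (p + 1) r
  | triangle {t : Set V} {p r : ℕ} {a b z : V} (h : TriangularExt G s t p r) (ha : a ∈ t)
      (hb : b ∈ t) (hab : G.Adj a b) (hz : z ∉ t) (hadj : ∀ c ∈ t, G.Adj z c ↔ c = a ∨ c = b) :
      TriangularExt G s (insert z t) p (r + 1)

namespace TriangularExt

variable {U : Type u} {V : Type v}

theorem trans {G : SimpleGraph V} {s t t' : Set V} {p r p' r' : ℕ}
    (h : TriangularExt G s t p r) (h' : TriangularExt G t t' p' r') :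
    TriangularExt G s t' (p + p') (r + r') := by
  induction h' with
  | refl => exact h
  | pendant _ ha hz hadj ih => exact ih.pendant ha hz hadj
  | triangle _ ha hb hab hz hadj ih => exact ih.triangle ha hb hab hz hadj

theorem image {G : SimpleGraph U} {G' : SimpleGraph V} (f : G ↪g G') {s t : Set U} {p r : ℕ}
    (h : TriangularExt G s t p r) : TriangularExt G' (f '' s) (f '' t) p r := by
  induction h with
  | refl => exact .refl
  | @pendant t p r a z _ ha hz hadj ih =>
    rw [Set.image_insert_eq]
    refine ih.pendant (Set.mem_image_of_mem f ha) (by simpa using hz) ?_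
    rintro _ ⟨b, hb, rfl⟩
    simp [hadj b hb]
  | @triangle t p r a b z _ ha hb hab hz hadj ih =>
    rw [Set.image_insert_eq]
    refine ih.triangle (Set.mem_image_of_mem f ha) (Set.mem_image_of_mem f hb)
      (f.map_adj_iff.2 hab) (by simpa using hz) ?_
    rintro _ ⟨c, hc, rfl⟩
    simp [hadj c hc]

theorem image_iso {G : SimpleGraph U} {G' : SimpleGraph V} (f : G ≃g G') {s : Set U} {p r : ℕ}
    (h : TriangularExt G s .univ p r) : TriangularExt G' (f '' s) .univ p r := by
  have := h.image f.toEmbedding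
  rwa [Set.image_univ, show Set.range f.toEmbedding = Set.univ from f.surjective.range_eq] at this

end TriangularExt

/-! ### Triangle-trees and trees -/

theorem SimpleGraph.map_adj_iff_of_injective {U : Type u} {V : Type v} (G : SimpleGraph U)
    {f : U → V} (hf : Function.Injective f) (a b : V) :
    (G.map f).Adj a b ↔ ∃ x y, G.Adj x y ∧ f x = a ∧ f y = b :=
  SimpleGraph.map_adj ⟨f, hf⟩ G a b

section Identify

variable {U : Type u} {V : Type v} (T : SimpleGraph U) (u : U) (H : SimpleGraph V) (v : V)

theorem identifyMap_self : identifyMap u v u = Sum.inl v := by simp [identifyMap]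

theorem identifyMap_of_ne {x : U} (h : x ≠ u) : identifyMap u v x = Sum.inr ⟨x, h⟩ := by
  simp [identifyMap, h]

theorem identifyMap_injective : Function.Injective (identifyMap u v) := by
  intro x y h
  by_cases hx : x = u <;> by_cases hy : y = u <;> simp_all [identifyMap]

theorem identifyVertex_adj_inl (a b : V) :
    (identifyVertex T u H v).Adj (Sum.inl a) (Sum.inl b) ↔ H.Adj a b := by
  rw [identifyVertex, SimpleGraph.sup_adj,
    SimpleGraph.map_adj_iff_of_injective _ Sum.inl_injective,
    SimpleGraph.map_adj_iff_of_injective _ (identifyMap_injective u v)]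
  constructor
  · rintro (⟨x, y, h, hx, hy⟩ | ⟨x, y, h, hx, hy⟩)
    · cases hx; cases hy; exact h
    · by_cases hxu : x = u <;> by_cases hyu : y = u <;> simp_all [identifyMap]
  · exact fun h => Or.inl ⟨a, b, h, rfl, rfl⟩

theorem identifyVertex_adj_identifyMap (x y : U) :
    (identifyVertex T u H v).Adj (identifyMap u v x) (identifyMap u v y) ↔ T.Adj x y := by
  rw [identifyVertex, SimpleGraph.sup_adj,
    SimpleGraph.map_adj_iff_of_injective _ Sum.inl_injective,
    SimpleGraph.map_adj_iff_of_injective _ (identifyMap_injective u v)]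
  constructor
  · rintro (⟨a, b, h, hx, hy⟩ | ⟨a, b, h, hx, hy⟩)
    · by_cases hxu : x = u <;> by_cases hyu : y = u <;> simp_all [identifyMap]
    · rwa [← identifyMap_injective u v hx, ← identifyMap_injective u v hy]
  · exact fun h => Or.inr ⟨x, y, h, rfl, rfl⟩

theorem not_identifyVertex_adj_inr_inl (x : {x : U // x ≠ u}) {b : V} (hb : b ≠ v) :
    ¬ (identifyVertex T u H v).Adj (Sum.inr x) (Sum.inl b) := by
  rw [identifyVertex, SimpleGraph.sup_adj,
    SimpleGraph.map_adj_iff_of_injective _ Sum.inl_injective,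
    SimpleGraph.map_adj_iff_of_injective _ (identifyMap_injective u v)]
  rintro (⟨a, c, h, hx, hy⟩ | ⟨a, c, h, hx, hy⟩)
  · simp at hx
  · by_cases hc : c = u
    · subst hc; rw [identifyMap_self] at hy; exact hb (Sum.inl_injective hy).symm
    · rw [identifyMap_of_ne u v hc] at hy; simp at hy

/-- The copy of `H` inside `T *_u^v H`. -/
def identifyVertexInl : H ↪g identifyVertex T u H v where
  toFun := Sum.inl
  inj' := Sum.inl_injective
  map_rel_iff' := identifyVertex_adj_inl T u H v _ _

theorem range_inl_union_image_identifyMap :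
    Set.range Sum.inl ∪ identifyMap u v '' Set.univ = Set.univ := by
  refine Set.eq_univ_of_forall fun x => ?_
  rcases x with x | ⟨x, hx⟩
  · exact .inl ⟨x, rfl⟩
  · exact .inr ⟨x, trivial, identifyMap_of_ne u v hx⟩

/-- A construction of `t ∋ u` in `T`, started from `u`, can be carried out in `T *_u^v H` on
top of the whole copy of `H`. -/
theorem TriangularExt.identifyVertex_union_image {T : SimpleGraph U} {u : U} {t : Set U} {p r : ℕ}
    (h : TriangularExt T {u} t p r) :
    u ∈ t ∧ TriangularExt (identifyVertex T u H v) (Set.range Sum.inl)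
      (Set.range Sum.inl ∪ identifyMap u v '' t) p r := by
  -- a new vertex of `T` has the same neighbours in `T *_u^v H` as in `T`
  have key {t : Set U} {z : U} (hut : u ∈ t) (hz : z ∉ t) (q : V ⊕ {x : U // x ≠ u} → Prop)
      (hq : ∀ b, q (Sum.inl b) → b = v)
      (hadj : ∀ c ∈ t, T.Adj z c ↔ q (identifyMap u v c)) :
      identifyMap u v z ∉ Set.range Sum.inl ∪ identifyMap u v '' t ∧
      ∀ c ∈ Set.range Sum.inl ∪ identifyMap u v '' t,
        (identifyVertex T u H v).Adj (identifyMap u v z) c ↔ q c := by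
    have hzu : z ≠ u := fun h => hz (h ▸ hut)
    constructor
    · rintro (⟨b, hb⟩ | ⟨y, hy, hyz⟩)
      · rw [identifyMap_of_ne u v hzu] at hb; simp at hb
      · exact hz (identifyMap_injective u v hyz ▸ hy)
    · have h₂ : ∀ c ∈ t, (identifyVertex T u H v).Adj (identifyMap u v z) (identifyMap u v c) ↔
          q (identifyMap u v c) := fun c hc => by
        rw [identifyVertex_adj_identifyMap, hadj c hc]
      rintro _ (⟨b, rfl⟩ | ⟨c, hc, rfl⟩)
      · by_cases hb : b = v
        · subst hb; have := h₂ u hut; rwa [identifyMap_self] at this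
        · refine iff_of_false ?_ fun h => hb (hq b h)
          rw [identifyMap_of_ne u v hzu]
          exact not_identifyVertex_adj_inr_inl T u H v _ hb
      · exact h₂ c hc
  have eq_inl {a : U} {b : V} (h : Sum.inl b = identifyMap u v a) : b = v := by
    by_cases ha : a = u
    · subst ha; rw [identifyMap_self] at h; exact Sum.inl_injective h
    · rw [identifyMap_of_ne u v ha] at h; simp at h
  induction h with
  | refl =>
    refine ⟨rfl, ?_⟩
    have : Set.range Sum.inl ∪ identifyMap u v '' {u} = Set.range Sum.inl := by
      simp [identifyMap_self]
    rw [this]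
    exact .refl
  | @pendant t p r a z _ ha hz hadj ih =>
    rw [Set.image_insert_eq, Set.union_insert]
    obtain ⟨h₁, h₂⟩ := key ih.1 hz (· = identifyMap u v a) (fun b => eq_inl)
      (fun c hc => by rw [hadj c hc, (identifyMap_injective u v).eq_iff])
    exact ⟨.inr ih.1, ih.2.pendant (.inr ⟨a, ha, rfl⟩) h₁ h₂⟩
  | @triangle t p r a b z _ ha hb hab hz hadj ih =>
    rw [Set.image_insert_eq, Set.union_insert]
    obtain ⟨h₁, h₂⟩ := key ih.1 hz (fun c => c = identifyMap u v a ∨ c = identifyMap u v b)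
      (fun b h => h.elim eq_inl eq_inl)
      (fun c hc => by simp only [hadj c hc, (identifyMap_injective u v).eq_iff])
    exact ⟨.inr ih.1, ih.2.triangle (.inr ⟨a, ha, rfl⟩) (.inr ⟨b, hb, rfl⟩)
      ((identifyVertex_adj_identifyMap T u H v a b).2 hab) h₁ h₂⟩

theorem TriangularExt.identifyVertex {T : SimpleGraph U} {u : U} {H : SimpleGraph V} (v : V)
    {a : V} {p r p' r' : ℕ} (hH : TriangularExt H {a} .univ p r)
    (hT : TriangularExt T {u} .univ p' r') :
    TriangularExt (identifyVertex T u H v) {Sum.inl a} .univ (p + p') (r + r') := by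
  have h₁ := hH.image (identifyVertexInl T u H v)
  have h₂ := (hT.identifyVertex_union_image H v).2
  rw [range_inl_union_image_identifyMap] at h₂
  rw [Set.image_singleton, Set.image_univ] at h₁
  exact h₁.trans h₂

end Identify

theorem TriangularExt.fin_three :
    TriangularExt (⊤ : SimpleGraph (Fin 3)) {0} .univ 1 1 := by
  have h₁ : TriangularExt (⊤ : SimpleGraph (Fin 3)) {0} {1, 0} 1 0 :=
    TriangularExt.refl.pendant (a := 0) (z := 1) rfl (by simp) (by simp)
  have h₂ := h₁.triangle (a := 0) (b := 1) (z := 2) (by simp) (by simp) (by simp) (by simp)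
    (by simp)
  convert h₂
  ext i; fin_cases i <;> simp

theorem TriangularExt.identifyTriangleEdge {V : Type u} {H : SimpleGraph V} {a b c : V}
    {p r : ℕ} (hH : TriangularExt H {c} .univ p r) (hab : H.Adj a b) :
    TriangularExt (identifyTriangleEdge H a b) {some c} .univ p (r + 1) := by
  have hadj (x y : V) : (_root_.identifyTriangleEdge H a b).Adj (some x) (some y) ↔ H.Adj x y := by
    simp [_root_.identifyTriangleEdge,
      SimpleGraph.map_adj_iff_of_injective _ (Option.some_injective V)]
  let f : H ↪g _root_.identifyTriangleEdge H a b :=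
    { toFun := some, inj' := Option.some_injective V, map_rel_iff' := hadj _ _ }
  have h₁ := hH.image f
  have h₂ := h₁.triangle (a := some a) (b := some b) (z := none) ⟨a, trivial, rfl⟩
    ⟨b, trivial, rfl⟩ ((hadj a b).2 hab) (by rintro ⟨x, -, hx⟩; cases hx) (by
      rintro _ ⟨x, -, rfl⟩
      change (_root_.identifyTriangleEdge H a b).Adj none (some x) ↔ some x = some a ∨ some x = some b
      simp [_root_.identifyTriangleEdge,
      SimpleGraph.map_adj_iff_of_injective _ (Option.some_injective V)])
  rw [Set.image_singleton] at h₂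
  convert h₂ using 1
  · rfl
  refine (Set.eq_univ_of_forall fun x => ?_).symm
  cases x
  · simp
  · exact .inr ⟨_, trivial, rfl⟩

/-- Gluing a triangle along a vertex adds a pendant vertex and then a vertex over the new edge. The
first triangle already has a pendant vertex, whence `1 ≤ p`. -/
theorem IsTriangleTree.exists_triangularExt {V : Type u} {H : SimpleGraph V}
    (hH : IsTriangleTree H) : ∃ a p r, 1 ≤ p ∧ TriangularExt H {a} .univ p r := by
  induction hH with
  | triangle e =>
    have := TriangularExt.fin_three.image_iso e.symm
    rw [Set.image_singleton] at this
    exact ⟨_, _, _, le_rfl, this⟩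
  | vertex hH a e ih =>
    obtain ⟨c, p, r, hp, h⟩ := ih
    have := (h.identifyVertex a TriangularExt.fin_three).image_iso e.symm
    rw [Set.image_singleton] at this
    exact ⟨_, _, _, by omega, this⟩
  | edge hH a b hab e ih =>
    obtain ⟨c, p, r, hp, h⟩ := ih
    have := (h.identifyTriangleEdge hab).image_iso e.symm
    rw [Set.image_singleton] at this
    exact ⟨_, _, _, by omega, this⟩

open Classical in
/-- Remove a leaf other than `u` and add it back as a pendant vertex. -/
theorem SimpleGraph.IsTree.exists_triangularExt {U : Type u} [Fintype U] {T : SimpleGraph U}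
    (hT : T.IsTree) (u : U) : ∃ p, TriangularExt T {u} .univ p 0 := by
  induction hn : Fintype.card U using Nat.strong_induction_on generalizing U with
  | _ n ih =>
  subst hn
  rcases subsingleton_or_nontrivial U with hU | hU
  · refine ⟨0, ?_⟩
    rw [Set.eq_univ_of_forall (s := {u}) fun x => Subsingleton.elim x u]
    exact .refl
  · obtain ⟨x, hxu, hx⟩ : ∃ x, x ≠ u ∧ T.degree x = 1 := by
      obtain ⟨x, y, hxy, hx, hy⟩ := hT.exists_ne_and_degree_eq_one
      by_cases hxu : x = u
      · exact ⟨y, fun h => hxy (hxu.trans h.symm), hy⟩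
      · exact ⟨x, hxu, hx⟩
    have hT' : (T.induce {x}ᶜ).IsTree :=
      ⟨hT.connected.induce_compl_singleton_of_degree_eq_one hx, hT.isAcyclic.induce _⟩
    obtain ⟨p, hp⟩ := ih (Fintype.card ({x}ᶜ : Set U)) (by
      rw [← Set.toFinset_card]; simp [Finset.card_compl, Fintype.card_pos]) hT' ⟨u, hxu.symm⟩ rfl
    have h := hp.image (SimpleGraph.Embedding.induce {x}ᶜ)
    obtain ⟨a, ha, ha'⟩ := SimpleGraph.degree_eq_one_iff_existsUnique_adj.1 hx
    have h' := h.pendant (a := a) (z := x) ⟨⟨a, ha.ne'⟩, trivial, rfl⟩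
      (by rintro ⟨y, -, hy⟩; exact y.2 hy) (by
        rintro b -
        exact ⟨ha' b, fun h => h ▸ ha⟩)
    refine ⟨p + 1, ?_⟩
    rw [Set.image_singleton] at h'
    convert h' using 1
    · rfl
    refine (Set.eq_univ_of_forall fun y => ?_).symm
    by_cases hy : y = x
    · simp [hy]
    · exact .inr ⟨⟨y, hy⟩, trivial, rfl⟩

/-! ### Counting vertices and edges -/

section EdgesIn

variable {V : Type u} [Fintype V]

open Classical in
/-- The edges of `G` with both ends in `s`. -/
noncomputable def edgesIn (G : SimpleGraph V) (s : Set V) : Finset (Sym2 V) :=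
  {e ∈ G.edgeFinset | ∀ x ∈ e, x ∈ s}

theorem mk_mem_edgesIn {G : SimpleGraph V} {s : Set V} {a b : V} :
    s(a, b) ∈ edgesIn G s ↔ G.Adj a b ∧ a ∈ s ∧ b ∈ s := by
  simp [edgesIn]

theorem edgesIn_singleton (G : SimpleGraph V) (a : V) : edgesIn G {a} = ∅ := by
  ext e
  induction e with | _ x y
  simp only [mk_mem_edgesIn, Set.mem_singleton_iff, Finset.notMem_empty, iff_false]
  rintro ⟨h, rfl, rfl⟩
  exact h.ne rfl

open Classical in
theorem edgesIn_univ (G : SimpleGraph V) : edgesIn G .univ = G.edgeFinset := by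
  simp [edgesIn]

theorem notMem_edgesIn {G : SimpleGraph V} {t : Set V} {a z : V} (hz : z ∉ t) :
    s(z, a) ∉ edgesIn G t := fun h => hz (mk_mem_edgesIn.1 h).2.1

open Classical in
theorem edgesIn_insert_pendant {G : SimpleGraph V} {t : Set V} {a z : V} (ha : a ∈ t)
    (hadj : ∀ b ∈ t, G.Adj z b ↔ b = a) :
    edgesIn G (insert z t) = insert s(z, a) (edgesIn G t) := by
  ext e
  induction e with | _ x y
  simp only [Finset.mem_insert, mk_mem_edgesIn, Set.mem_insert_iff, Sym2.eq_iff]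
  constructor
  · rintro ⟨h, rfl | hx, rfl | hy⟩
    · exact (h.ne rfl).elim
    · exact .inl (.inl ⟨rfl, (hadj y hy).1 h⟩)
    · exact .inl (.inr ⟨(hadj x hx).1 h.symm, rfl⟩)
    · exact .inr ⟨h, hx, hy⟩
  · have := (hadj a ha).2 rfl
    rintro ((⟨rfl, rfl⟩ | ⟨rfl, rfl⟩) | ⟨h, hx, hy⟩)
    exacts [⟨this, .inl rfl, .inr ha⟩, ⟨this.symm, .inr ha, .inl rfl⟩, ⟨h, .inr hx, .inr hy⟩]

open Classical in
theorem edgesIn_insert_triangle {G : SimpleGraph V} {t : Set V} {a b z : V} (ha : a ∈ t)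
    (hb : b ∈ t) (hadj : ∀ c ∈ t, G.Adj z c ↔ c = a ∨ c = b) :
    edgesIn G (insert z t) = insert s(z, a) (insert s(z, b) (edgesIn G t)) := by
  ext e
  induction e with | _ x y
  simp only [Finset.mem_insert, mk_mem_edgesIn, Set.mem_insert_iff, Sym2.eq_iff]
  have h₁ := (hadj a ha).2 (.inl rfl)
  have h₂ := (hadj b hb).2 (.inr rfl)
  constructor
  · rintro ⟨h, rfl | hx, rfl | hy⟩
    · exact (h.ne rfl).elim
    · rcases (hadj y hy).1 h with rfl | rfl <;> simp
    · rcases (hadj x hx).1 h.symm with rfl | rfl <;> simp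
    · exact .inr (.inr ⟨h, hx, hy⟩)
  · rintro ((⟨rfl, rfl⟩ | ⟨rfl, rfl⟩) | (⟨rfl, rfl⟩ | ⟨rfl, rfl⟩) | ⟨h, hx, hy⟩)
    exacts [⟨h₁, .inl rfl, .inr ha⟩, ⟨h₁.symm, .inr ha, .inl rfl⟩, ⟨h₂, .inl rfl, .inr hb⟩,
      ⟨h₂.symm, .inr hb, .inl rfl⟩, ⟨h, .inr hx, .inr hy⟩]

theorem TriangularExt.card_eq {G : SimpleGraph V} {a : V} {t : Set V} {p r : ℕ}
    (h : TriangularExt G {a} t p r) :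
    t.ncard = p + r + 1 ∧ (edgesIn G t).card = p + 2 * r := by
  classical
  induction h with
  | refl => simp [edgesIn_singleton]
  | @pendant t p r a z _ ha hz hadj ih =>
    rw [Set.ncard_insert_of_notMem hz, edgesIn_insert_pendant ha hadj,
      Finset.card_insert_of_notMem (notMem_edgesIn hz)]
    omega
  | @triangle t p r a b z _ ha hb hab hz hadj ih =>
    rw [Set.ncard_insert_of_notMem hz, edgesIn_insert_triangle ha hb hadj,
      Finset.card_insert_of_notMem, Finset.card_insert_of_notMem (notMem_edgesIn hz)]
    · omega
    · rw [Finset.mem_insert, not_or]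
      refine ⟨fun h => hab.ne (Sym2.congr_right.1 h), notMem_edgesIn hz⟩

theorem TriangularExt.numEdges_eq {G : SimpleGraph V} {a : V} {p r : ℕ}
    (h : TriangularExt G {a} .univ p r) : numEdges G = p + 2 * r := by
  classical
  rw [numEdges, Nat.card_eq_fintype_card, ← SimpleGraph.edgeFinset_card, ← h.card_eq.2,
    edgesIn_univ]

theorem TriangularExt.card_vertices {G : SimpleGraph V} {a : V} {p r : ℕ}
    (h : TriangularExt G {a} .univ p r) : Nat.card V = p + r + 1 := by
  rw [← Set.ncard_univ, h.card_eq.1]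

theorem TriangularExt.phi_eq {G : SimpleGraph V} {a : V} {p r : ℕ}
    (h : TriangularExt G {a} .univ p r) : phi G = r := by
  rw [phi, h.numEdges_eq, h.card_vertices]; push_cast; ring

theorem TriangularExt.kappa_eq {G : SimpleGraph V} {a : V} {p r : ℕ}
    (h : TriangularExt G {a} .univ p r) : kappa G = r - p := by
  rw [kappa, h.numEdges_eq, h.card_vertices]; push_cast; ring

end EdgesIn

/-! ### Densities and logarithmic integrals -/

theorem lintegral_withDensity_ofReal {α : Type*} [MeasurableSpace α] {μ : Measure α} {f : α → ℝ}
    (hf : Measurable f) {g : α → ENNReal} (hg : Measurable g) :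
    ∫⁻ x, g x ∂μ.withDensity (fun x => ENNReal.ofReal (f x)) =
      ∫⁻ x, ENNReal.ofReal (f x) * g x ∂μ :=
  lintegral_withDensity_eq_lintegral_mul _ hf.ennreal_ofReal hg

theorem integral_withDensity_ofReal {α : Type*} [MeasurableSpace α] {μ : Measure α} {f : α → ℝ}
    (hf : Measurable f) (hf₀ : ∀ x, 0 ≤ f x) (g : α → ℝ) :
    ∫ x, g x ∂μ.withDensity (fun x => ENNReal.ofReal (f x)) = ∫ x, g x * f x ∂μ := by
  rw [integral_withDensity_eq_integral_toReal_smul hf.ennreal_ofReal (by simp)]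
  simp [ENNReal.toReal_ofReal (hf₀ _), mul_comm]

theorem integrable_withDensity_ofReal {α : Type*} [MeasurableSpace α] {μ : Measure α} {f : α → ℝ}
    (hf : Measurable f) (hf₀ : ∀ x, 0 ≤ f x) {g : α → ℝ} :
    Integrable g (μ.withDensity fun x => ENNReal.ofReal (f x)) ↔
      Integrable (fun x => g x * f x) μ := by
  rw [integrable_withDensity_iff hf.ennreal_ofReal (by simp)]
  simp [ENNReal.toReal_ofReal (hf₀ _)]

theorem integral_eq_one_of_isProbabilityMeasure_withDensity {α : Type*} [MeasurableSpace α]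
    {μ : Measure α} {f : α → ℝ} (hf : Measurable f) (hf₀ : ∀ x, 0 ≤ f x)
    (h : IsProbabilityMeasure (μ.withDensity fun x => ENNReal.ofReal (f x))) :
    ∫ x, f x ∂μ = 1 := by
  have := integral_withDensity_ofReal (μ := μ) hf hf₀ fun _ => 1
  simpa using this.symm

theorem integrable_comp_of_map_eq {α β : Type*} [MeasurableSpace α] [MeasurableSpace β]
    {μ : Measure α} {ν : Measure β} {f : α → β} (hf : Measurable f) (h : μ.map f = ν)
    {g : β → ℝ} (hg : Measurable g) (hi : Integrable g ν) :
    Integrable (fun x => g (f x)) μ ∧ ∫ x, g (f x) ∂μ = ∫ y, g y ∂ν := by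
  subst h
  exact ⟨(integrable_map_measure hg.aestronglyMeasurable hf.aemeasurable).1 hi,
    (integral_map hf.aemeasurable hg.aestronglyMeasurable).symm⟩

section LogIntegral

variable {α : Type*} [MeasurableSpace α] {μ : Measure α} [IsProbabilityMeasure μ]
  {w h : α → ℝ} {t : ℝ}

theorem abs_log_mul_le {x : ℝ} (h₀ : 0 ≤ x) (h₁ : x ≤ 1) : |Real.log x * x| ≤ 1 := by
  rcases h₀.eq_or_lt with rfl | h₀
  · simp
  · exact (Real.abs_log_mul_self_lt x h₀ h₁).le

theorem integrable_log_mul (hw : Measurable w) (hw₀ : ∀ x, 0 ≤ w x) (hw₁ : ∀ x, w x ≤ 1)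
    (hh : Measurable h) (hh₀ : ∀ x, 0 ≤ h x) (hh₁ : ∀ x, h x ≤ 1) (ht : 0 < t) :
    Integrable (fun x => Real.log (h x) * (w x * h x / t)) μ := by
  refine Integrable.of_bound (C := 1 / t) (by fun_prop) (.of_forall fun x => ?_)
  rw [show Real.log (h x) * (w x * h x / t) = w x * (Real.log (h x) * h x) / t by ring,
    Real.norm_eq_abs, abs_div, abs_mul, abs_of_pos ht, abs_of_nonneg (hw₀ x)]
  gcongr
  exact mul_le_one₀ (hw₁ x) (abs_nonneg _) (abs_log_mul_le (hh₀ x) (hh₁ x))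

/-- Gibbs' inequality for the probability density `w h / t` relative to the weight `w`: the
expectation of `log (h / t)` is at least `- log ∫ w`. -/
theorem log_sub_log_le_integral_log_mul (hw : Measurable w) (hw₀ : ∀ x, 0 ≤ w x)
    (hw₁ : ∀ x, w x ≤ 1) (hh : Measurable h) (hh₀ : ∀ x, 0 ≤ h x) (hh₁ : ∀ x, h x ≤ 1)
    (ht : 0 < t) (hone : ∫ x, w x * h x / t ∂μ = 1) :
    0 < ∫ x, w x ∂μ ∧ Real.log t - Real.log (∫ x, w x ∂μ) ≤
      ∫ x, Real.log (h x) * (w x * h x / t) ∂μ := by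
  have hwi : Integrable w μ := Integrable.of_bound (C := 1) (by fun_prop)
    (.of_forall fun x => by rw [Real.norm_eq_abs, abs_of_nonneg (hw₀ x)]; exact hw₁ x)
  have hi : Integrable (fun x => w x * h x / t) μ := by
    by_contra hn
    rw [integral_undef hn] at hone
    exact zero_ne_one hone
  set m := ∫ x, w x ∂μ with hm
  have hm₀ : 0 < m := by
    have : 1 ≤ m / t := by
      rw [← hone, hm, ← integral_div]
      refine integral_mono hi (hwi.div_const t) fun x => ?_
      have := mul_le_of_le_one_right (hw₀ x) (hh₁ x)
      show w x * h x / t ≤ w x / t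
      gcongr
    by_contra hm₀
    exact absurd (this.trans (div_nonpos_of_nonpos_of_nonneg (not_lt.1 hm₀) ht.le)) (by norm_num)
  refine ⟨hm₀, ?_⟩
  have hli := integrable_log_mul (μ := μ) hw hw₀ hw₁ hh hh₀ hh₁ ht
  have key : ∫ x, ((Real.log t - Real.log m) * (w x * h x / t)
      - Real.log (h x) * (w x * h x / t)) ∂μ ≤ ∫ x, (w x / m - w x * h x / t) ∂μ := by
    refine integral_mono ((hi.const_mul _).sub hli) ((hwi.div_const m).sub hi) fun x => ?_
    show (Real.log t - Real.log m) * (w x * h x / t) - Real.log (h x) * (w x * h x / t) ≤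
      w x / m - w x * h x / t
    -- the inequality `log y ≤ y - 1` at `y = t / (m h)`; the density vanishes where `h` does
    rcases (hh₀ x).eq_or_lt with h0 | h0
    · rw [← h0]; simpa using div_nonneg (hw₀ x) hm₀.le
    · have h1 : Real.log t - Real.log m - Real.log (h x) ≤ t / (m * h x) - 1 := by
        rw [sub_sub, ← Real.log_mul hm₀.ne' h0.ne', ← Real.log_div ht.ne' (by positivity)]
        exact Real.log_le_sub_one_of_pos (by positivity)
      calc _ = (Real.log t - Real.log m - Real.log (h x)) * (w x * h x / t) := by ring
        _ ≤ (t / (m * h x) - 1) * (w x * h x / t) := by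
          have := hw₀ x
          gcongr
        _ = _ := by field_simp
  rw [integral_sub (hi.const_mul _) hli, integral_sub (hwi.div_const m) hi, integral_const_mul,
    hone, integral_div, ← hm, div_self hm₀.ne'] at key
  linarith

end LogIntegral

/-! ### The vertices and edges of a random triangle -/

namespace Graphon

variable (W : Graphon)

@[fun_prop]
theorem measurable_toFun_comp {α : Type*} [MeasurableSpace α] {f g : α → unitInterval}
    (hf : Measurable f) (hg : Measurable g) : Measurable fun a => W.toFun (f a) (g a) :=
  W.measurable.comp (hf.prodMk hg)

theorem evalPair_nonneg {V : Type u} (x : V → unitInterval) (e : Sym2 V) :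
    0 ≤ W.evalPair x e := by
  induction e with | _ a b
  exact W.nonneg _ _

theorem evalPair_le_one {V : Type u} (x : V → unitInterval) (e : Sym2 V) :
    W.evalPair x e ≤ 1 := by
  induction e with | _ a b
  exact W.le_one _ _

@[fun_prop]
theorem measurable_evalPair {V : Type u} (e : Sym2 V) :
    Measurable fun x : V → unitInterval => W.evalPair x e := by
  induction e with | _ a b
  exact W.measurable_toFun_comp (measurable_pi_apply a) (measurable_pi_apply b)

/-- The normalized codegree `∫ W(x, z) W(y, z) dz` of `x` and `y`. -/
noncomputable def codegree (x y : unitInterval) : ℝ :=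
  (∫⁻ z, ENNReal.ofReal (W.toFun x z * W.toFun y z)).toReal

/-- The density `∫∫ W(x, y) W(x, z) W(y, z) dy dz` of the triangles at `x`. -/
noncomputable def triangleDegree (x : unitInterval) : ℝ :=
  (∫⁻ y, ENNReal.ofReal (W.toFun x y * W.codegree x y)).toReal

/-- The edge density, as an integral over `[0,1]²`. -/
noncomputable def edgeDensity : ℝ :=
  ∫ p : unitInterval × unitInterval, W.toFun p.1 p.2

/-- The triangle density, as an iterated integral. -/
noncomputable def triangleDensity : ℝ :=
  (∫⁻ x, ENNReal.ofReal (W.triangleDegree x)).toReal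

theorem lintegral_ofReal_le_one {f : unitInterval → ℝ} (hf : ∀ x, f x ≤ 1) :
    ∫⁻ x, ENNReal.ofReal (f x) ≤ 1 := by
  calc ∫⁻ x, ENNReal.ofReal (f x) ≤ ∫⁻ _ : unitInterval, 1 :=
        lintegral_mono fun x => ENNReal.ofReal_le_one.2 (hf x)
    _ = 1 := by simp

theorem toReal_lintegral_ofReal_le_one {f : unitInterval → ℝ} (hf : ∀ x, f x ≤ 1) :
    (∫⁻ x, ENNReal.ofReal (f x)).toReal ≤ 1 :=
  ENNReal.toReal_le_of_le_ofReal zero_le_one (by simpa using lintegral_ofReal_le_one hf)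

theorem ofReal_toReal_lintegral {f : unitInterval → ℝ} (hf : ∀ x, f x ≤ 1) :
    ENNReal.ofReal (∫⁻ x, ENNReal.ofReal (f x)).toReal = ∫⁻ x, ENNReal.ofReal (f x) :=
  ENNReal.ofReal_toReal (ne_top_of_le_ne_top ENNReal.one_ne_top (lintegral_ofReal_le_one hf))

theorem codegree_nonneg (x y : unitInterval) : 0 ≤ W.codegree x y := ENNReal.toReal_nonneg

theorem triangleDegree_nonneg (x : unitInterval) : 0 ≤ W.triangleDegree x := ENNReal.toReal_nonneg

theorem triangleDensity_nonneg : 0 ≤ W.triangleDensity := ENNReal.toReal_nonneg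

theorem cherry_le_one (x y z : unitInterval) : W.toFun x z * W.toFun y z ≤ 1 :=
  mul_le_one₀ (W.le_one _ _) (W.nonneg _ _) (W.le_one _ _)

theorem codegree_le_one (x y : unitInterval) : W.codegree x y ≤ 1 :=
  toReal_lintegral_ofReal_le_one fun z => W.cherry_le_one x y z

theorem mul_codegree_nonneg (x y : unitInterval) : 0 ≤ W.toFun x y * W.codegree x y :=
  mul_nonneg (W.nonneg _ _) (W.codegree_nonneg _ _)

theorem mul_codegree_le_one (x y : unitInterval) : W.toFun x y * W.codegree x y ≤ 1 :=
  mul_le_one₀ (W.le_one _ _) (W.codegree_nonneg _ _) (W.codegree_le_one _ _)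

theorem triangleDegree_le_one (x : unitInterval) : W.triangleDegree x ≤ 1 :=
  toReal_lintegral_ofReal_le_one fun y => W.mul_codegree_le_one x y

theorem ofReal_codegree (x y : unitInterval) : ENNReal.ofReal (W.codegree x y) =
    ∫⁻ z, ENNReal.ofReal (W.toFun x z * W.toFun y z) :=
  ofReal_toReal_lintegral fun z => W.cherry_le_one x y z

theorem ofReal_triangleDegree (x : unitInterval) : ENNReal.ofReal (W.triangleDegree x) =
    ∫⁻ y, ENNReal.ofReal (W.toFun x y * W.codegree x y) :=
  ofReal_toReal_lintegral fun y => W.mul_codegree_le_one x y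

theorem ofReal_triangleDensity : ENNReal.ofReal W.triangleDensity =
    ∫⁻ x, ENNReal.ofReal (W.triangleDegree x) :=
  ofReal_toReal_lintegral W.triangleDegree_le_one

theorem codegree_comm (x y : unitInterval) : W.codegree x y = W.codegree y x := by
  simp only [codegree, mul_comm]

@[fun_prop]
theorem measurable_codegree_comp {α : Type*} [MeasurableSpace α] {f g : α → unitInterval}
    (hf : Measurable f) (hg : Measurable g) : Measurable fun a => W.codegree (f a) (g a) := by
  unfold codegree
  refine Measurable.ennreal_toReal (Measurable.lintegral_prod_right' (f := fun p : α × unitInterval =>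
    ENNReal.ofReal (W.toFun (f p.1) p.2 * W.toFun (g p.1) p.2)) ?_)
  fun_prop

theorem measurable_triangleDegree : Measurable W.triangleDegree := by
  unfold triangleDegree
  refine Measurable.ennreal_toReal (Measurable.lintegral_prod_right'
    (f := fun p : unitInterval × unitInterval =>
      ENNReal.ofReal (W.toFun p.1 p.2 * W.codegree p.1 p.2)) ?_)
  fun_prop

@[fun_prop]
theorem measurable_triangleDegree_comp {α : Type*} [MeasurableSpace α] {f : α → unitInterval}
    (hf : Measurable f) : Measurable fun a => W.triangleDegree (f a) :=
  W.measurable_triangleDegree.comp hf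

/-- The law of a vertex of a random triangle of `W`. -/
noncomputable def vertexLaw : Measure unitInterval :=
  volume.withDensity fun x => ENNReal.ofReal (W.triangleDegree x / W.triangleDensity)

/-- The law of an edge of a random triangle of `W`. -/
noncomputable def edgeLaw : Measure (unitInterval × unitInterval) :=
  volume.withDensity fun p =>
    ENNReal.ofReal (W.toFun p.1 p.2 * W.codegree p.1 p.2 / W.triangleDensity)

theorem lintegral_vertexLaw {Φ : unitInterval → ENNReal} (hΦ : Measurable Φ) :
    ∫⁻ x, Φ x ∂W.vertexLaw =
      ∫⁻ x, ENNReal.ofReal (W.triangleDegree x / W.triangleDensity) * Φ x :=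
  lintegral_withDensity_ofReal (by fun_prop) hΦ

theorem lintegral_edgeLaw {Φ : unitInterval × unitInterval → ENNReal} (hΦ : Measurable Φ) :
    ∫⁻ p, Φ p ∂W.edgeLaw = ∫⁻ x, ∫⁻ y,
      ENNReal.ofReal (W.toFun x y * W.codegree x y / W.triangleDensity) * Φ (x, y) := by
  rw [edgeLaw, lintegral_withDensity_ofReal (by fun_prop) hΦ, Measure.volume_eq_prod,
    lintegral_prod _ (by fun_prop)]

theorem map_swap_edgeLaw : W.edgeLaw.map Prod.swap = W.edgeLaw := by
  refine Measure.ext_of_lintegral _ fun Φ hΦ => ?_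
  rw [lintegral_map hΦ measurable_swap, W.lintegral_edgeLaw (Φ := fun p => Φ p.swap) (by fun_prop),
    lintegral_edgeLaw W hΦ, lintegral_lintegral_swap (by fun_prop)]
  refine lintegral_congr fun x => lintegral_congr fun y => ?_
  rw [Prod.swap_prod_mk, W.symm, W.codegree_comm]

theorem map_fst_edgeLaw : W.edgeLaw.map Prod.fst = W.vertexLaw := by
  refine Measure.ext_of_lintegral _ fun Φ hΦ => ?_
  rw [lintegral_map hΦ measurable_fst, W.lintegral_edgeLaw (Φ := fun p => Φ p.1) (by fun_prop),
    lintegral_vertexLaw W hΦ]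
  refine lintegral_congr fun x => ?_
  rw [lintegral_mul_const (Φ x) (by fun_prop)]
  congr 1
  simp only [div_eq_mul_inv, ENNReal.ofReal_mul (W.mul_codegree_nonneg x _),
    ENNReal.ofReal_mul (W.triangleDegree_nonneg x)]
  rw [lintegral_mul_const _ (by fun_prop), ofReal_triangleDegree]

theorem map_snd_edgeLaw : W.edgeLaw.map Prod.snd = W.vertexLaw := by
  rw [← map_fst_edgeLaw, ← map_swap_edgeLaw, Measure.map_map measurable_snd measurable_swap,
    map_swap_edgeLaw]
  rfl

variable {W}

theorem isProbabilityMeasure_vertexLaw (hW : 0 < W.triangleDensity) :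
    IsProbabilityMeasure W.vertexLaw := by
  refine ⟨?_⟩
  rw [← lintegral_one, lintegral_vertexLaw W measurable_const]
  simp only [div_eq_mul_inv, ENNReal.ofReal_mul (W.triangleDegree_nonneg _), mul_one]
  rw [lintegral_mul_const _ (by fun_prop), ← ofReal_triangleDensity,
    ← ENNReal.ofReal_mul hW.le, mul_inv_cancel₀ hW.ne', ENNReal.ofReal_one]

theorem isProbabilityMeasure_edgeLaw (hW : 0 < W.triangleDensity) :
    IsProbabilityMeasure W.edgeLaw := by
  have := isProbabilityMeasure_vertexLaw hW
  rw [← map_fst_edgeLaw] at this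
  exact Measure.isProbabilityMeasure_of_map Prod.fst


theorem integrable_log_triangleDegree (hW : 0 < W.triangleDensity) :
    Integrable (fun x => Real.log (W.triangleDegree x)) W.vertexLaw := by
  rw [vertexLaw, integrable_withDensity_ofReal
    (f := fun x => W.triangleDegree x / W.triangleDensity) (by fun_prop)
    fun x => div_nonneg (W.triangleDegree_nonneg x) hW.le]
  have h := integrable_log_mul (μ := (volume : Measure unitInterval)) (w := fun _ => 1)
    measurable_const (fun _ => zero_le_one) (fun _ => le_rfl) W.measurable_triangleDegree
    W.triangleDegree_nonneg W.triangleDegree_le_one hW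
  simpa only [one_mul] using h

theorem integrable_log_codegree (hW : 0 < W.triangleDensity) :
    Integrable (fun p => Real.log (W.codegree p.1 p.2)) W.edgeLaw := by
  rw [edgeLaw, integrable_withDensity_ofReal (f := fun p : unitInterval × unitInterval =>
      W.toFun p.1 p.2 * W.codegree p.1 p.2 / W.triangleDensity) (by fun_prop)
    fun p => div_nonneg (W.mul_codegree_nonneg p.1 p.2) hW.le]
  exact integrable_log_mul (μ := volume)
    (w := fun p : unitInterval × unitInterval => W.toFun p.1 p.2) (by fun_prop)
    (fun p => W.nonneg _ _) (fun p => W.le_one _ _) (by fun_prop)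
    (fun p => W.codegree_nonneg _ _) (fun p => W.codegree_le_one _ _) hW

/-- The law of a vertex has nonnegative relative entropy with respect to the uniform measure. -/
theorem log_triangleDensity_le (hW : 0 < W.triangleDensity) :
    Real.log W.triangleDensity ≤ ∫ x, Real.log (W.triangleDegree x) ∂W.vertexLaw := by
  have h₀ (x) : 0 ≤ W.triangleDegree x / W.triangleDensity :=
    div_nonneg (W.triangleDegree_nonneg x) hW.le
  have h₁ := integral_eq_one_of_isProbabilityMeasure_withDensity (by fun_prop) h₀
    (isProbabilityMeasure_vertexLaw hW)
  rw [vertexLaw, integral_withDensity_ofReal (by fun_prop) h₀]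
  have h := (log_sub_log_le_integral_log_mul (μ := (volume : Measure unitInterval))
    (w := fun _ => 1) measurable_const (fun _ => zero_le_one) (fun _ => le_rfl)
    W.measurable_triangleDegree W.triangleDegree_nonneg W.triangleDegree_le_one hW
    (by simpa only [one_mul] using h₁)).2
  simpa only [one_mul, integral_const, probReal_univ, one_smul, Real.log_one, sub_zero] using h

/-- The law of an edge of a random triangle, compared with the measure of density `W`. -/
theorem log_triangleDensity_sub_log_le (hW : 0 < W.triangleDensity) :
    0 < W.edgeDensity ∧ Real.log W.triangleDensity - Real.log W.edgeDensity ≤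
      ∫ p, Real.log (W.codegree p.1 p.2) ∂W.edgeLaw := by
  have h₀ (p : unitInterval × unitInterval) :
      0 ≤ W.toFun p.1 p.2 * W.codegree p.1 p.2 / W.triangleDensity :=
    div_nonneg (W.mul_codegree_nonneg _ _) hW.le
  have h₁ := integral_eq_one_of_isProbabilityMeasure_withDensity (by fun_prop) h₀
    (isProbabilityMeasure_edgeLaw hW)
  rw [edgeLaw, integral_withDensity_ofReal (by fun_prop) h₀]
  exact log_sub_log_le_integral_log_mul (μ := volume)
    (w := fun p : unitInterval × unitInterval => W.toFun p.1 p.2) (by fun_prop)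
    (fun p => W.nonneg _ _) (fun p => W.le_one _ _) (by fun_prop)
    (fun p => W.codegree_nonneg _ _) (fun p => W.codegree_le_one _ _) hW h₁

theorem ae_triangleDegree_pos : ∀ᵐ x ∂W.vertexLaw, 0 < W.triangleDegree x := by
  rw [vertexLaw, ae_withDensity_iff (by fun_prop)]
  refine .of_forall fun x hx => (W.triangleDegree_nonneg x).lt_of_ne fun h => hx ?_
  simp [← h]

theorem ae_codegree_pos : ∀ᵐ p ∂W.edgeLaw, 0 < W.codegree p.1 p.2 := by
  rw [edgeLaw, ae_withDensity_iff (by fun_prop)]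
  refine .of_forall fun p hp => (W.codegree_nonneg p.1 p.2).lt_of_ne fun h => hp ?_
  simp [← h]

/-- The density of the conditional law of the other end of an edge of a random triangle, given
that one end is `x`. It is `0` if `x` lies in no triangle, as then the divisor is `0`. -/
noncomputable def edgeKernel (W : Graphon) (x z : unitInterval) : ℝ :=
  W.toFun x z * W.codegree x z / W.triangleDegree x

/-- The density of the conditional law of the third vertex of a random triangle, given that the
other two are `x` and `y`. It is `0` if the codegree of `x` and `y` is `0`. -/
noncomputable def triangleKernel (W : Graphon) (x y z : unitInterval) : ℝ :=
  W.toFun x z * W.toFun y z / W.codegree x y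

theorem edgeKernel_nonneg (x z : unitInterval) : 0 ≤ W.edgeKernel x z :=
  div_nonneg (W.mul_codegree_nonneg _ _) (W.triangleDegree_nonneg _)

theorem triangleKernel_nonneg (x y z : unitInterval) : 0 ≤ W.triangleKernel x y z :=
  div_nonneg (mul_nonneg (W.nonneg _ _) (W.nonneg _ _)) (W.codegree_nonneg _ _)

theorem triangleKernel_comm (x y z : unitInterval) :
    W.triangleKernel x y z = W.triangleKernel y x z := by
  rw [triangleKernel, triangleKernel, codegree_comm, mul_comm (W.toFun x z)]

@[fun_prop]
theorem measurable_edgeKernel_comp {α : Type*} [MeasurableSpace α] {f g : α → unitInterval}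
    (hf : Measurable f) (hg : Measurable g) : Measurable fun a => W.edgeKernel (f a) (g a) := by
  unfold edgeKernel
  fun_prop

@[fun_prop]
theorem measurable_triangleKernel_comp {α : Type*} [MeasurableSpace α]
    {f g h : α → unitInterval} (hf : Measurable f) (hg : Measurable g) (hh : Measurable h) :
    Measurable fun a => W.triangleKernel (f a) (g a) (h a) := by
  unfold triangleKernel
  fun_prop

theorem lintegral_edgeKernel {x : unitInterval} (hx : 0 < W.triangleDegree x) :
    ∫⁻ z, ENNReal.ofReal (W.edgeKernel x z) = 1 := by
  simp only [edgeKernel, div_eq_mul_inv, ENNReal.ofReal_mul (W.mul_codegree_nonneg _ _)]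
  rw [lintegral_mul_const _ (by fun_prop), ← ofReal_triangleDegree,
    ← ENNReal.ofReal_mul hx.le, mul_inv_cancel₀ hx.ne', ENNReal.ofReal_one]

theorem lintegral_triangleKernel {x y : unitInterval} (hxy : 0 < W.codegree x y) :
    ∫⁻ z, ENNReal.ofReal (W.triangleKernel x y z) = 1 := by
  simp only [triangleKernel, div_eq_mul_inv,
    ENNReal.ofReal_mul (mul_nonneg (W.nonneg x _) (W.nonneg y _))]
  rw [lintegral_mul_const _ (by fun_prop), ← ofReal_codegree,
    ← ENNReal.ofReal_mul hxy.le, mul_inv_cancel₀ hxy.ne', ENNReal.ofReal_one]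

/-- Disintegration of `edgeLaw` over `vertexLaw`. -/
theorem lintegral_vertexLaw_edgeKernel {Φ : unitInterval × unitInterval → ENNReal}
    (hΦ : Measurable Φ) :
    ∫⁻ x, (∫⁻ z, ENNReal.ofReal (W.edgeKernel x z) * Φ (x, z)) ∂W.vertexLaw =
      ∫⁻ p, Φ p ∂W.edgeLaw := by
  rw [lintegral_vertexLaw W (Measurable.lintegral_prod_right' (f := fun p : unitInterval ×
    unitInterval => ENNReal.ofReal (W.edgeKernel p.1 p.2) * Φ p) (by fun_prop)),
    lintegral_edgeLaw W hΦ]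
  refine lintegral_congr fun x => ?_
  rw [← lintegral_const_mul _ (by fun_prop)]
  rcases (W.triangleDegree_nonneg x).eq_or_lt with h | h
  · -- if no triangle contains `x`, both sides vanish, as `W(x, z) c(x, z) = 0` for almost all `z`
    have h₁ := W.ofReal_triangleDegree x
    rw [← h, ENNReal.ofReal_zero, eq_comm, lintegral_eq_zero_iff (by fun_prop)] at h₁
    refine lintegral_congr_ae (h₁.mono fun z hz => ?_)
    have hz' : W.toFun x z * W.codegree x z = 0 :=
      le_antisymm (ENNReal.ofReal_eq_zero.1 hz) (W.mul_codegree_nonneg x z)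
    simp [← h, hz']
  · refine lintegral_congr fun z => ?_
    rw [← mul_assoc, ← ENNReal.ofReal_mul
      (div_nonneg (W.triangleDegree_nonneg x) W.triangleDensity_nonneg), edgeKernel]
    congr 2
    field_simp

/-- A vertex of a random edge together with a random third vertex of a triangle on that edge is
again a random edge. -/
theorem lintegral_edgeLaw_triangleKernel {Φ : unitInterval × unitInterval → ENNReal}
    (hΦ : Measurable Φ) :
    ∫⁻ p, (∫⁻ z, ENNReal.ofReal (W.triangleKernel p.1 p.2 z) * Φ (p.1, z)) ∂W.edgeLaw =
      ∫⁻ p, Φ p ∂W.edgeLaw := by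
  rw [lintegral_edgeLaw W (Measurable.lintegral_prod_right' (f := fun q : (unitInterval ×
    unitInterval) × unitInterval =>
      ENNReal.ofReal (W.triangleKernel q.1.1 q.1.2 q.2) * Φ (q.1.1, q.2)) (by fun_prop)),
    lintegral_edgeLaw W hΦ]
  refine lintegral_congr fun x => ?_
  have h₁ (y : unitInterval) :
      ENNReal.ofReal (W.toFun x y * W.codegree x y / W.triangleDensity) *
        ∫⁻ z, ENNReal.ofReal (W.triangleKernel x y z) * Φ (x, z) =
      ∫⁻ z, ENNReal.ofReal (W.toFun x z / W.triangleDensity) * Φ (x, z) *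
        ENNReal.ofReal (W.toFun x y * W.toFun z y) := by
    rw [← lintegral_const_mul _ (by fun_prop)]
    rcases (W.codegree_nonneg x y).eq_or_lt with h | h
    · -- if the codegree of `x` and `y` is `0`, both sides vanish
      have h₁ := W.ofReal_codegree x y
      rw [← h, ENNReal.ofReal_zero, eq_comm, lintegral_eq_zero_iff (by fun_prop)] at h₁
      refine lintegral_congr_ae (h₁.mono fun z hz => ?_)
      have hz' : W.toFun x z * W.toFun y z = 0 :=
        le_antisymm (ENNReal.ofReal_eq_zero.1 hz) (mul_nonneg (W.nonneg _ _) (W.nonneg _ _))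
      rcases mul_eq_zero.1 hz' with h' | h'
      · simp [← h, h']
      · simp [← h, W.symm z y, h']
    · refine lintegral_congr fun z => ?_
      rw [← mul_assoc, mul_right_comm _ (Φ (x, z)), ← ENNReal.ofReal_mul (div_nonneg
        (W.mul_codegree_nonneg x y) W.triangleDensity_nonneg), ← ENNReal.ofReal_mul
        (div_nonneg (W.nonneg x z) W.triangleDensity_nonneg), triangleKernel, W.symm z y]
      congr 2
      field_simp
  -- integrating out `y` first, the paths from `x` to `z` through `y` give the codegree of `x`, `z`
  simp only [h₁]
  rw [lintegral_lintegral_swap (by fun_prop)]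
  refine lintegral_congr fun z => ?_
  rw [lintegral_const_mul _ (by fun_prop), ← ofReal_codegree, mul_right_comm,
    ← ENNReal.ofReal_mul (div_nonneg (W.nonneg x z) W.triangleDensity_nonneg)]
  congr 2
  ring

end Graphon

/-! ### Densities on powers of the unit interval -/

theorem lintegral_pi_eq_lintegral_update {V : Type u} [Fintype V] [DecidableEq V] (z : V)
    {f : (V → unitInterval) → ENNReal} (hf : Measurable f) :
    ∫⁻ x, f x = ∫⁻ x, ∫⁻ t, f (Function.update x z t) := by
  have hm := hf.lmarginal (fun _ : V => (volume : Measure unitInterval)) (s := {z})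
  have key := lintegral_eq_of_lmarginal_eq (μ := fun _ : V => (volume : Measure unitInterval)) {z}
    hf hm (by
      funext x
      rw [lmarginal_singleton (∫⋯∫⁻_{z}, f ∂fun _ => volume)]
      simp [lmarginal_update_of_mem (fun _ : V => (volume : Measure unitInterval))
        (Finset.mem_singleton_self z) f])
  rwa [lmarginal_singleton] at key

theorem lintegral_pi_eval {V : Type u} [Fintype V] (a : V) {f : unitInterval → ENNReal}
    (hf : Measurable f) : ∫⁻ x : V → unitInterval, f (x a) = ∫⁻ t, f t :=
  (measurePreserving_eval (fun _ : V => (volume : Measure unitInterval)) a).lintegral_comp hf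

theorem DependsOn.update_eq {V : Type u} [DecidableEq V] {β : Type*} {s : Set V}
    {f : (V → unitInterval) → β} (hf : DependsOn f s) {z : V} (hz : z ∉ s)
    (x : V → unitInterval) (t : unitInterval) : f (Function.update x z t) = f x :=
  hf fun _ hi => Function.update_of_ne (ne_of_mem_of_not_mem hi hz) _ _

section Density

variable {V : Type u} [Fintype V]

/-- The measure on `[0,1]^V` with density `F`. -/
noncomputable def measureOfDensity (F : (V → unitInterval) → ℝ) : Measure (V → unitInterval) :=
  volume.withDensity fun x => ENNReal.ofReal (F x)

/-- Multiplying a density that does not involve the coordinate `z` by a factor `K`: the coordinate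
`z` is drawn from the density `K`, conditionally on the others. -/
theorem lintegral_measureOfDensity_mul [DecidableEq V] {s : Set V} {z : V} (hz : z ∉ s)
    {F K : (V → unitInterval) → ℝ} (hF : Measurable F) (hF₀ : ∀ x, 0 ≤ F x) (hFs : DependsOn F s)
    (hK : Measurable K) {Φ : (V → unitInterval) → ENNReal} (hΦ : Measurable Φ) :
    ∫⁻ x, Φ x ∂measureOfDensity (fun x => F x * K x) =
      ∫⁻ x, (∫⁻ t, ENNReal.ofReal (K (Function.update x z t)) * Φ (Function.update x z t))
        ∂measureOfDensity F := by
  have hu : Measurable fun p : (V → unitInterval) × unitInterval => Function.update p.1 z p.2 :=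
    measurable_update'
  have hm : Measurable fun p : (V → unitInterval) × unitInterval =>
      ENNReal.ofReal (K (Function.update p.1 z p.2)) * Φ (Function.update p.1 z p.2) :=
    (hK.comp hu).ennreal_ofReal.mul (hΦ.comp hu)
  rw [measureOfDensity, lintegral_withDensity_ofReal (by fun_prop) hΦ, measureOfDensity,
    lintegral_withDensity_ofReal hF hm.lintegral_prod_right',
    lintegral_pi_eq_lintegral_update z (by fun_prop)]
  refine lintegral_congr fun x => ?_
  have hmx : Measurable fun t =>
      ENNReal.ofReal (K (Function.update x z t)) * Φ (Function.update x z t) :=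
    hm.comp (by fun_prop : Measurable fun t => (x, t))
  rw [← lintegral_const_mul _ hmx]
  refine lintegral_congr fun t => ?_
  rw [hFs.update_eq hz, ENNReal.ofReal_mul (hF₀ x), mul_assoc]

/-- Drawing the coordinate `z` from a conditional probability density does not change the law of a
function of the other coordinates. -/
theorem map_measureOfDensity_mul [DecidableEq V] {s : Set V} {z : V} (hz : z ∉ s)
    {F K : (V → unitInterval) → ℝ} (hF : Measurable F) (hF₀ : ∀ x, 0 ≤ F x) (hFs : DependsOn F s)
    (hK : Measurable K) (hK₁ : ∀ᵐ x ∂measureOfDensity F,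
      ∫⁻ t, ENNReal.ofReal (K (Function.update x z t)) = 1)
    {E : Type*} [MeasurableSpace E] {g : (V → unitInterval) → E} (hg : Measurable g)
    (hgs : DependsOn g s) :
    (measureOfDensity fun x => F x * K x).map g = (measureOfDensity F).map g := by
  refine Measure.ext_of_lintegral _ fun Φ hΦ => ?_
  rw [lintegral_map hΦ hg, lintegral_map hΦ hg,
    lintegral_measureOfDensity_mul (Φ := fun x => Φ (g x)) hz hF hF₀ hFs hK (hΦ.comp hg)]
  refine lintegral_congr_ae (hK₁.mono fun x hx => ?_)
  have hKx : Measurable fun t => ENNReal.ofReal (K (Function.update x z t)) :=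
    (hK.comp (measurable_update x)).ennreal_ofReal
  simp only [hgs.update_eq hz]
  rw [lintegral_mul_const _ hKx, hx, one_mul]

end Density

/-! ### Random copies with triangular marginals -/

/-- The function `F` is the density of a random map `s → [0,1]` (written as a function on `[0,1]^V`
that does not involve the coordinates outside `s`) under which every vertex and every edge of `G[s]`
is distributed like a vertex or an edge of a random triangle of `W`. The function `l` is such that
`F e^l` is at most the product of the values of `W` at the edges of `G[s]`, and `m` is its
expectation with respect to `F`. -/
structure IsTriangularLaw {V : Type u} [Fintype V] (W : Graphon) (G : SimpleGraph V) (s : Set V)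
    (m : ℝ) (F l : (V → unitInterval) → ℝ) : Prop where
  measurable_density : Measurable F
  nonneg : ∀ x, 0 ≤ F x
  dependsOn_density : DependsOn F s
  measurable_exponent : Measurable l
  dependsOn_exponent : DependsOn l s
  mul_exp_le : ∀ x, F x * Real.exp (l x) ≤ ∏ e ∈ edgesIn G s, W.evalPair x e
  map_vertex : ∀ a ∈ s, (measureOfDensity F).map (fun x => x a) = W.vertexLaw
  map_edge : ∀ a ∈ s, ∀ b ∈ s, G.Adj a b →
    (measureOfDensity F).map (fun x => (x a, x b)) = W.edgeLaw
  integrable : Integrable l (measureOfDensity F)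
  integral_eq : ∫ x, l x ∂measureOfDensity F = m

namespace IsTriangularLaw

variable {V : Type u} [Fintype V] {W : Graphon} {G : SimpleGraph V} {s : Set V} {m : ℝ}
  {F l : (V → unitInterval) → ℝ}

theorem congr_expectation {m' : ℝ} (h : IsTriangularLaw W G s m F l) (hm : m = m') :
    IsTriangularLaw W G s m' F l :=
  hm ▸ h

/-- One vertex with the law `W.vertexLaw`: there is no edge, and the exponent is minus the logarithm
of the density. -/
theorem singleton (hW : 0 < W.triangleDensity) (a : V) :
    IsTriangularLaw W G {a}
      (Real.log W.triangleDensity - ∫ x, Real.log (W.triangleDegree x) ∂W.vertexLaw)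
      (fun x => W.triangleDegree (x a) / W.triangleDensity)
      (fun x => Real.log W.triangleDensity - Real.log (W.triangleDegree (x a))) := by
  have hmap : (measureOfDensity fun x : V → unitInterval =>
      W.triangleDegree (x a) / W.triangleDensity).map (fun x => x a) = W.vertexLaw := by
    refine Measure.ext_of_lintegral _ fun Φ hΦ => ?_
    rw [lintegral_map hΦ (measurable_pi_apply a), W.lintegral_vertexLaw hΦ, measureOfDensity,
      lintegral_withDensity_ofReal (g := fun x : V → unitInterval => Φ (x a)) (by fun_prop)
        (by fun_prop)]
    exact lintegral_pi_eval a
      (f := fun t => ENNReal.ofReal (W.triangleDegree t / W.triangleDensity) * Φ t) (by fun_prop)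
  have := Graphon.isProbabilityMeasure_vertexLaw hW
  have hlog := W.measurable_triangleDegree.log
  have hi := Graphon.integrable_log_triangleDegree hW
  have : IsProbabilityMeasure (measureOfDensity fun x : V → unitInterval =>
      W.triangleDegree (x a) / W.triangleDensity) := by
    rw [← hmap] at this
    exact Measure.isProbabilityMeasure_of_map fun x => x a
  have hi' : Integrable (fun x : V → unitInterval => Real.log (W.triangleDegree (x a)))
      (measureOfDensity fun x : V → unitInterval =>
        W.triangleDegree (x a) / W.triangleDensity) := by
    rw [← hmap, integrable_map_measure hlog.aestronglyMeasurable
      (measurable_pi_apply a).aemeasurable] at hi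
    exact hi
  exact {
    measurable_density := by fun_prop
    nonneg := fun x => div_nonneg (W.triangleDegree_nonneg _) hW.le
    dependsOn_density := fun x y h => by simp only [h a rfl]
    measurable_exponent := by fun_prop
    dependsOn_exponent := fun x y h => by simp only [h a rfl]
    mul_exp_le := fun x => by
      rw [edgesIn_singleton, Finset.prod_empty, Real.exp_sub, Real.exp_log hW]
      rcases (W.triangleDegree_nonneg (x a)).eq_or_lt with h | h
      · simp [← h]
      · rw [Real.exp_log h]; field_simp; rfl
    map_vertex := by rintro _ rfl; exact hmap
    map_edge := by rintro _ rfl _ rfl h; exact (h.ne rfl).elim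
    integrable := (integrable_const _).sub hi'
    integral_eq := by
      rw [integral_sub (integrable_const _) hi', ← hmap,
        integral_map (measurable_pi_apply a).aemeasurable hlog.aestronglyMeasurable]
      simp }

/-- Adding a vertex `z`, drawn from the conditional density `K`. It suffices to check the law of the
edges between `z` and its neighbours. -/
theorem insert_vertex [DecidableEq V] (h : IsTriangularLaw W G s m F l) {z : V} (hz : z ∉ s)
    {K q : (V → unitInterval) → ℝ} {m' : ℝ} (hK : Measurable K) (hK₀ : ∀ x, 0 ≤ K x)
    (hKs : DependsOn K (insert z s))
    (hq : Measurable q) (hqs : DependsOn q (insert z s))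
    (hle : ∀ x, (∏ e ∈ edgesIn G s, W.evalPair x e) * (K x * Real.exp (q x)) ≤
      ∏ e ∈ edgesIn G (insert z s), W.evalPair x e)
    (hK₁ : ∀ᵐ x ∂measureOfDensity F,
      ∫⁻ t, ENNReal.ofReal (K (Function.update x z t)) = 1)
    (hne : ∃ a ∈ s, G.Adj z a)
    (hmap : ∀ a ∈ s, G.Adj z a →
      (measureOfDensity fun x => F x * K x).map (fun x => (x a, x z)) = W.edgeLaw)
    (hqi : Integrable q (measureOfDensity fun x => F x * K x))
    (hqm : ∫ x, q x ∂measureOfDensity (fun x => F x * K x) = m') :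
    IsTriangularLaw W G (insert z s) (m + m') (fun x => F x * K x) (fun x => l x + q x) := by
  have hs : s ⊆ insert z s := Set.subset_insert z s
  have hold {E : Type _} [MeasurableSpace E] {g : (V → unitInterval) → E} (hg : Measurable g)
      (hgs : DependsOn g s) :
      (measureOfDensity fun x => F x * K x).map g = (measureOfDensity F).map g :=
    map_measureOfDensity_mul hz h.measurable_density h.nonneg h.dependsOn_density hK
      hK₁ hg hgs
  have hid : ProbabilityTheory.IdentDistrib l l (measureOfDensity fun x => F x * K x)
      (measureOfDensity F) :=
    ⟨h.measurable_exponent.aemeasurable, h.measurable_exponent.aemeasurable,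
      hold h.measurable_exponent h.dependsOn_exponent⟩
  have hli := hid.integrable_iff.2 h.integrable
  have hF := h.measurable_density
  have hl := h.measurable_exponent
  exact {
    measurable_density := by fun_prop
    nonneg := fun x => mul_nonneg (h.nonneg x) (hK₀ x)
    dependsOn_density := fun x y hxy => by
      simp only [h.dependsOn_density.mono hs hxy, hKs hxy]
    measurable_exponent := by fun_prop
    dependsOn_exponent := fun x y hxy => by
      simp only [h.dependsOn_exponent.mono hs hxy, hqs hxy]
    mul_exp_le := fun x => by
      refine le_trans ?_ (hle x)
      rw [Real.exp_add, mul_mul_mul_comm]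
      exact mul_le_mul_of_nonneg_right (h.mul_exp_le x)
        (mul_nonneg (hK₀ x) (Real.exp_nonneg _))
    map_vertex := by
      rintro a (rfl | ha)
      · obtain ⟨b, hb, hab⟩ := hne
        rw [← W.map_snd_edgeLaw, ← hmap b hb hab, Measure.map_map (by fun_prop) (by fun_prop)]
        rfl
      · rw [hold (by fun_prop) fun x y hxy => hxy a ha, h.map_vertex a ha]
    map_edge := by
      rintro a (rfl | ha) b (rfl | hb) hab
      · exact (hab.ne rfl).elim
      · rw [← W.map_swap_edgeLaw, ← hmap b hb hab, Measure.map_map (by fun_prop) (by fun_prop)]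
        rfl
      · exact hmap a ha hab.symm
      · rw [hold (by fun_prop) fun x y hxy => by rw [hxy a ha, hxy b hb], h.map_edge a ha b hb hab]
    integrable := hli.add hqi
    integral_eq := by
      rw [integral_add hli hqi, hid.integral_eq, h.integral_eq, hqm] }

/-- A vertex `z` attached to `a` is drawn from `W.edgeKernel` at `x a`. -/
theorem pendant (hW : 0 < W.triangleDensity) (h : IsTriangularLaw W G s m F l) {a z : V}
    (ha : a ∈ s) (hz : z ∉ s) (hadj : ∀ b ∈ s, G.Adj z b ↔ b = a) :
    IsTriangularLaw W G (insert z s)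
      (m + (∫ x, Real.log (W.triangleDegree x) ∂W.vertexLaw -
        ∫ p, Real.log (W.codegree p.1 p.2) ∂W.edgeLaw))
      (fun x => F x * W.edgeKernel (x a) (x z))
      (fun x => l x +
        (Real.log (W.triangleDegree (x a)) - Real.log (W.codegree (x a) (x z)))) := by
  classical
  have haz : a ≠ z := fun h => hz (h ▸ ha)
  have hza : G.Adj z a := (hadj a ha).2 rfl
  have hK : Measurable fun x : V → unitInterval => W.edgeKernel (x a) (x z) := by fun_prop
  have hpos : ∀ᵐ x ∂measureOfDensity F, 0 < W.triangleDegree (x a) := by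
    have := W.ae_triangleDegree_pos
    rw [← h.map_vertex a ha] at this
    exact ae_of_ae_map (measurable_pi_apply a).aemeasurable this
  have hedge : (measureOfDensity fun x => F x * W.edgeKernel (x a) (x z)).map
      (fun x => (x a, x z)) = W.edgeLaw := by
    refine Measure.ext_of_lintegral _ fun Φ hΦ => ?_
    have hm : Measurable fun t => ∫⁻ y, ENNReal.ofReal (W.edgeKernel t y) * Φ (t, y) :=
      Measurable.lintegral_prod_right' (f := fun p : unitInterval × unitInterval =>
        ENNReal.ofReal (W.edgeKernel p.1 p.2) * Φ p) (by fun_prop)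
    rw [lintegral_map hΦ (by fun_prop), lintegral_measureOfDensity_mul hz h.measurable_density
      h.nonneg h.dependsOn_density hK (by fun_prop), ← W.lintegral_vertexLaw_edgeKernel hΦ,
      ← h.map_vertex a ha, lintegral_map hm (by fun_prop)]
    simp [haz]
  have hvert : (measureOfDensity fun x => F x * W.edgeKernel (x a) (x z)).map
      (fun x => x a) = W.vertexLaw := by
    rw [← W.map_fst_edgeLaw, ← hedge, Measure.map_map (by fun_prop) (by fun_prop)]
    rfl
  obtain ⟨hi₁, he₁⟩ := integrable_comp_of_map_eq (by fun_prop) hvert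
    W.measurable_triangleDegree.log (Graphon.integrable_log_triangleDegree hW)
  obtain ⟨hi₂, he₂⟩ := integrable_comp_of_map_eq (by fun_prop) hedge (by fun_prop)
    (Graphon.integrable_log_codegree hW)
  refine h.insert_vertex hz hK (fun x => W.edgeKernel_nonneg _ _)
    (fun x y hxy => by rw [hxy a (.inr ha), hxy z (.inl rfl)]) (by fun_prop)
    (fun x y hxy => by rw [hxy a (.inr ha), hxy z (.inl rfl)]) (fun x => ?_)
    (hpos.mono fun x hx => ?_) ⟨a, ha, hza⟩ ?_ (hi₁.sub hi₂) ?_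
  · rw [edgesIn_insert_pendant ha hadj, Finset.prod_insert (notMem_edgesIn hz), mul_comm]
    refine mul_le_mul_of_nonneg_right ?_ (Finset.prod_nonneg fun e _ => W.evalPair_nonneg x e)
    change _ ≤ W.toFun (x z) (x a)
    rw [W.symm (x z), Graphon.edgeKernel, Real.exp_sub]
    rcases (W.triangleDegree_nonneg (x a)).eq_or_lt with h₁ | h₁
    · simpa [← h₁] using W.nonneg _ _
    rcases (W.codegree_nonneg (x a) (x z)).eq_or_lt with h₂ | h₂
    · simpa [← h₂] using W.nonneg _ _
    rw [Real.exp_log h₁, Real.exp_log h₂]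
    field_simp
    rfl
  · simpa [haz] using W.lintegral_edgeKernel hx
  · intro b hb hzb
    rw [(hadj b hb).1 hzb]
    exact hedge
  · rw [integral_sub hi₁ hi₂, he₁, he₂]

/-- A vertex `z` attached to the ends of the edge `ab` is drawn from `W.triangleKernel` at `x a` and
`x b`. -/
theorem triangle (hW : 0 < W.triangleDensity) (h : IsTriangularLaw W G s m F l) {a b z : V}
    (ha : a ∈ s) (hb : b ∈ s) (hab : G.Adj a b) (hz : z ∉ s)
    (hadj : ∀ c ∈ s, G.Adj z c ↔ c = a ∨ c = b) :
    IsTriangularLaw W G (insert z s)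
      (m + ∫ p, Real.log (W.codegree p.1 p.2) ∂W.edgeLaw)
      (fun x => F x * W.triangleKernel (x a) (x b) (x z))
      (fun x => l x + Real.log (W.codegree (x a) (x b))) := by
  classical
  have haz : a ≠ z := fun h => hz (h ▸ ha)
  have hbz : b ≠ z := fun h => hz (h ▸ hb)
  have hza : G.Adj z a := (hadj a ha).2 (.inl rfl)
  have hK (a b : V) : Measurable fun x : V → unitInterval =>
    W.triangleKernel (x a) (x b) (x z) := by fun_prop
  have hpos : ∀ᵐ x ∂measureOfDensity F, 0 < W.codegree (x a) (x b) := by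
    have := W.ae_codegree_pos
    rw [← h.map_edge a ha b hb hab] at this
    exact ae_of_ae_map (f := fun x : V → unitInterval => (x a, x b)) (by fun_prop) this
  have hedge {a b : V} (ha : a ∈ s) (hb : b ∈ s) (hab : G.Adj a b) (haz : a ≠ z) (hbz : b ≠ z) :
      (measureOfDensity fun x => F x * W.triangleKernel (x a) (x b) (x z)).map
      (fun x => (x a, x z)) = W.edgeLaw := by
    refine Measure.ext_of_lintegral _ fun Φ hΦ => ?_
    have hm : Measurable fun p : unitInterval × unitInterval =>
        ∫⁻ y, ENNReal.ofReal (W.triangleKernel p.1 p.2 y) * Φ (p.1, y) :=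
      Measurable.lintegral_prod_right' (f := fun p : (unitInterval × unitInterval) × unitInterval =>
        ENNReal.ofReal (W.triangleKernel p.1.1 p.1.2 p.2) * Φ (p.1.1, p.2)) (by fun_prop)
    rw [lintegral_map hΦ (by fun_prop), lintegral_measureOfDensity_mul hz h.measurable_density
      h.nonneg h.dependsOn_density (hK a b) (by fun_prop), ← W.lintegral_edgeLaw_triangleKernel hΦ,
      ← h.map_edge a ha b hb hab, lintegral_map hm (by fun_prop)]
    simp [haz, hbz]
  have hone : ∀ᵐ x ∂measureOfDensity F, ∫⁻ t, ENNReal.ofReal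
      (W.triangleKernel (Function.update x z t a) (Function.update x z t b)
        (Function.update x z t z)) = 1 := hpos.mono fun x hx => by
    simpa [haz, hbz] using W.lintegral_triangleKernel hx
  have hedge₀ : (measureOfDensity fun x => F x * W.triangleKernel (x a) (x b) (x z)).map
      (fun x => (x a, x b)) = W.edgeLaw := by
    rw [← h.map_edge a ha b hb hab]
    exact map_measureOfDensity_mul hz h.measurable_density h.nonneg h.dependsOn_density (hK a b)
      hone (by fun_prop) fun x y hxy => by rw [hxy a ha, hxy b hb]
  obtain ⟨hi, he⟩ := integrable_comp_of_map_eq (by fun_prop) hedge₀ (by fun_prop)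
    (Graphon.integrable_log_codegree hW)
  refine h.insert_vertex hz (hK a b) (fun x => W.triangleKernel_nonneg _ _ _)
    (fun x y hxy => by rw [hxy a (.inr ha), hxy b (.inr hb), hxy z (.inl rfl)]) (by fun_prop)
    (fun x y hxy => by rw [hxy a (.inr ha), hxy b (.inr hb)]) (fun x => ?_)
    hone ⟨a, ha, hza⟩ ?_ hi he
  · rw [edgesIn_insert_triangle ha hb hadj, Finset.prod_insert, Finset.prod_insert
      (notMem_edgesIn hz), ← mul_assoc (W.evalPair x s(z, a)),
      mul_comm (∏ e ∈ edgesIn G s, W.evalPair x e) (_ * _)]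
    · refine mul_le_mul_of_nonneg_right ?_ (Finset.prod_nonneg fun e _ => W.evalPair_nonneg x e)
      change _ ≤ W.toFun (x z) (x a) * W.toFun (x z) (x b)
      rw [W.symm (x z), W.symm (x z), Graphon.triangleKernel]
      have h₀ : 0 ≤ W.toFun (x a) (x z) * W.toFun (x b) (x z) :=
        mul_nonneg (W.nonneg _ _) (W.nonneg _ _)
      rcases (W.codegree_nonneg (x a) (x b)).eq_or_lt with h₁ | h₁
      · simpa [← h₁] using h₀
      · rw [Real.exp_log h₁, div_mul_cancel₀ _ h₁.ne']
    · rw [Finset.mem_insert, not_or]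
      exact ⟨fun h => hab.ne (Sym2.congr_right.1 h), notMem_edgesIn hz⟩
  · intro c hc hzc
    rcases (hadj c hc).1 hzc with rfl | rfl
    · exact hedge ha hb hab haz hbz
    · rw [show (fun x => F x * W.triangleKernel (x a) (x c) (x z)) =
        fun x => F x * W.triangleKernel (x c) (x a) (x z) from
          funext fun x => by rw [W.triangleKernel_comm]]
      exact hedge hb ha hab.symm hbz haz

end IsTriangularLaw

theorem TriangularExt.exists_isTriangularLaw {V : Type u} [Fintype V] {W : Graphon}
    {G : SimpleGraph V} (hW : 0 < W.triangleDensity) {a : V} {t : Set V} {p r : ℕ}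
    (h : TriangularExt G {a} t p r) :
    ∃ F l, IsTriangularLaw W G t
      (Real.log W.triangleDensity +
        (p - 1) * ∫ x, Real.log (W.triangleDegree x) ∂W.vertexLaw +
        (r - p) * ∫ q, Real.log (W.codegree q.1 q.2) ∂W.edgeLaw) F l := by
  induction h with
  | refl =>
    exact ⟨_, _, (IsTriangularLaw.singleton hW a).congr_expectation (by push_cast; ring)⟩
  | pendant _ ha hz hadj ih =>
    obtain ⟨F, l, h⟩ := ih
    exact ⟨_, _, (h.pendant hW ha hz hadj).congr_expectation (by push_cast; ring)⟩
  | triangle _ ha hb hab hz hadj ih =>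
    obtain ⟨F, l, h⟩ := ih
    exact ⟨_, _, (h.triangle hW ha hb hab hz hadj).congr_expectation (by push_cast; ring)⟩

/-! ### Homomorphism densities -/

section HomDensity

variable {V : Type u} [Fintype V] (G : SimpleGraph V) (W : Graphon)

theorem homDensity_eq_integral : homDensity G W =
    ∫ x : V → unitInterval, ∏ e ∈ edgesIn G .univ, W.evalPair x e := by
  rw [edgesIn_univ]; rfl

theorem integrable_prod_evalPair (E : Finset (Sym2 V)) :
    Integrable (fun x : V → unitInterval => ∏ e ∈ E, W.evalPair x e) := by
  refine Integrable.of_bound (C := 1) (by fun_prop) (.of_forall fun x => ?_)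
  rw [Real.norm_eq_abs, abs_of_nonneg (Finset.prod_nonneg fun e _ => W.evalPair_nonneg x e)]
  exact Finset.prod_le_one (fun e _ => W.evalPair_nonneg x e) fun e _ => W.evalPair_le_one x e

theorem homDensity_nonneg : 0 ≤ homDensity G W := by
  rw [homDensity_eq_integral]
  exact integral_nonneg fun x => Finset.prod_nonneg fun e _ => W.evalPair_nonneg x e

theorem homDensity_eq_lintegral : homDensity G W = (∫⁻ x : V → unitInterval,
    ENNReal.ofReal (∏ e ∈ edgesIn G .univ, W.evalPair x e)).toReal := by
  rw [homDensity_eq_integral, integral_eq_lintegral_of_nonneg_ae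
    (.of_forall fun x => Finset.prod_nonneg fun e _ => W.evalPair_nonneg x e) (by fun_prop)]

theorem homDensity_fin_two : homDensity (⊤ : SimpleGraph (Fin 2)) W = W.edgeDensity := by
  have hE : edgesIn (⊤ : SimpleGraph (Fin 2)) .univ = {s(0, 1)} := by
    ext e
    induction e with | _ x y
    rw [mk_mem_edgesIn, SimpleGraph.top_adj]
    simp only [Set.mem_univ, and_true]
    revert x y
    decide
  rw [homDensity_eq_integral, hE, Graphon.edgeDensity,
    ← (volume_preserving_finTwoArrow unitInterval).integral_comp']
  simp [Graphon.evalPair, MeasurableEquiv.finTwoArrow]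

theorem homDensity_fin_three : homDensity (⊤ : SimpleGraph (Fin 3)) W = W.triangleDensity := by
  have hE : edgesIn (⊤ : SimpleGraph (Fin 3)) .univ = {s(0, 1), s(0, 2), s(1, 2)} := by
    ext e
    induction e with | _ x y
    rw [mk_mem_edgesIn, SimpleGraph.top_adj]
    simp only [Set.mem_univ, and_true]
    revert x y
    decide
  have hp (x : Fin 3 → unitInterval) : ∏ e ∈ edgesIn (⊤ : SimpleGraph (Fin 3)) .univ,
      W.evalPair x e = W.toFun (x 0) (x 1) * (W.toFun (x 0) (x 2) * W.toFun (x 1) (x 2)) := by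
    rw [hE, Finset.prod_insert (by decide), Finset.prod_insert (by decide),
      Finset.prod_singleton]
    rfl
  rw [homDensity_eq_lintegral, Graphon.triangleDensity]
  congr 1
  simp only [hp]
  rw [lintegral_pi_eq_lintegral_update 2 (by fun_prop)]
  have h₂ (x : Fin 3 → unitInterval) : ∫⁻ t, ENNReal.ofReal
      (W.toFun (Function.update x 2 t 0) (Function.update x 2 t 1) *
        (W.toFun (Function.update x 2 t 0) (Function.update x 2 t 2) *
          W.toFun (Function.update x 2 t 1) (Function.update x 2 t 2))) =
      ENNReal.ofReal (W.toFun (x 0) (x 1) * W.codegree (x 0) (x 1)) := by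
    rw [ENNReal.ofReal_mul (W.nonneg _ _), W.ofReal_codegree, ← lintegral_const_mul _ (by fun_prop)]
    refine lintegral_congr fun t => ?_
    simp [ENNReal.ofReal_mul (W.nonneg _ _)]
  simp only [h₂]
  rw [lintegral_pi_eq_lintegral_update 1 (by fun_prop),
    ← lintegral_pi_eval (0 : Fin 3) (by fun_prop)]
  refine lintegral_congr fun x => ?_
  simp [W.ofReal_triangleDegree]

variable {G W}

/-- Jensen's inequality for the exponential function: `t_G(W)` is at least the integral of `F e^l`,
the expectation of `e^l` with respect to `F`. -/
theorem IsTriangularLaw.exp_le_homDensity {m : ℝ} {F l : (V → unitInterval) → ℝ} [Nonempty V]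
    (hW : 0 < W.triangleDensity) (h : IsTriangularLaw W G .univ m F l) :
    Real.exp m ≤ homDensity G W := by
  have hprob : IsProbabilityMeasure (measureOfDensity F) := by
    obtain ⟨a⟩ := ‹Nonempty V›
    have := Graphon.isProbabilityMeasure_vertexLaw hW
    rw [← h.map_vertex a trivial] at this
    exact Measure.isProbabilityMeasure_of_map fun x => x a
  have hF := h.measurable_density
  have hl := h.measurable_exponent
  have hw := integrable_prod_evalPair W (edgesIn G .univ)
  have hFl : Integrable (fun x => Real.exp (l x) * F x) := by
    refine hw.mono' (by fun_prop) (.of_forall fun x => ?_)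
    rw [Real.norm_eq_abs, abs_of_nonneg (mul_nonneg (Real.exp_nonneg _) (h.nonneg x)), mul_comm]
    exact h.mul_exp_le x
  have hexp : Integrable (fun x => Real.exp (l x)) (measureOfDensity F) :=
    (integrable_withDensity_ofReal hF h.nonneg).2 hFl
  calc Real.exp m = Real.exp (∫ x, l x ∂measureOfDensity F) := by rw [h.integral_eq]
    _ ≤ ∫ x, Real.exp (l x) ∂measureOfDensity F :=
      convexOn_exp.map_integral_le Real.continuous_exp.continuousOn isClosed_univ
        (.of_forall fun _ => trivial) h.integrable hexp
    _ = ∫ x, Real.exp (l x) * F x := integral_withDensity_ofReal hF h.nonneg _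
    _ ≤ ∫ x, ∏ e ∈ edgesIn G .univ, W.evalPair x e := by
      refine integral_mono hFl hw fun x => ?_
      rw [mul_comm]
      exact h.mul_exp_le x
    _ = homDensity G W := (homDensity_eq_integral G W).symm

/-- The exponent `m` supplied by the construction is at least
`log t₃ + (p - 1) log t₃ + (r - p) (log t₃ - log t₂)`, where `t₂` and `t₃` are the edge
and triangle densities. -/
theorem TriangularExt.le_homDensity {a : V} {p r : ℕ} (h : TriangularExt G {a} .univ p r)
    (hp : 1 ≤ p) (hpr : p ≤ r) :
    W.triangleDensity ^ r / W.edgeDensity ^ (r - p) ≤ homDensity G W := by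
  -- without triangles there is no random triangle, but the left-hand side is `0`, as `0 < r`
  rcases W.triangleDensity_nonneg.eq_or_lt with hW | hW
  · rw [← hW, zero_pow (by omega), zero_div]
    exact homDensity_nonneg G W
  obtain ⟨F, l, hl⟩ := h.exists_isTriangularLaw hW
  have : Nonempty V := ⟨a⟩
  refine le_trans ?_ (hl.exp_le_homDensity hW)
  have hD := W.log_triangleDensity_le hW
  obtain ⟨hpos, hC⟩ := W.log_triangleDensity_sub_log_le hW
  rw [← Real.exp_log hW, ← Real.exp_log hpos, ← Real.exp_nat_mul, ← Real.exp_nat_mul,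
    ← Real.exp_sub, Real.exp_le_exp, Real.log_exp, Nat.cast_sub hpr]
  have h₁ : (0 : ℝ) ≤ p - 1 := by simpa using hp
  have h₂ : (0 : ℝ) ≤ r - p := by simpa using hpr
  nlinarith [mul_le_mul_of_nonneg_left hD h₁, mul_le_mul_of_nonneg_left hC h₂]

end HomDensity

theorem lemma3p4 {U : Type u} {V : Type v} [Fintype U] [DecidableEq U] [Fintype V]
    (H : SimpleGraph V) (hH : IsTriangleTree H)
    (T : SimpleGraph U) (hT : T.IsTree) (hTH : (numEdges T : ℤ) ≤ kappa H)
    (u : U) (v : V) (W : Graphon) :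
    homDensity (⊤ : SimpleGraph (Fin 3)) W ^ phi H /
        homDensity (⊤ : SimpleGraph (Fin 2)) W ^ (kappa H - (numEdges T : ℤ)) ≤
      homDensity (identifyVertex T u H v) W := by
  obtain ⟨a, p, r, hp, hr⟩ := hH.exists_triangularExt
  obtain ⟨q, hq⟩ := hT.exists_triangularExt u
  have hqT : numEdges T = q := by simpa using hq.numEdges_eq
  rw [hr.kappa_eq, hqT] at hTH
  have h := (hr.identifyVertex v hq).le_homDensity (W := W) (by omega) (by omega)
  rw [hr.phi_eq, hr.kappa_eq, hqT, homDensity_fin_two, homDensity_fin_three, zpow_natCast,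
    show (r - p - q : ℤ) = ((r - (p + q) : ℕ) : ℤ) by omega, zpow_natCast]
  exact h
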